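/- Let $(T_n)_{n\ge 1}$ be the uniform random recursive tree process: $T_1$ consists of the single vertex $1$ (the root), and for each $n \ge 1$ the tree $T_{n+1}$ is obtained from $T_n$ by adding a new vertex $n+1$ and joining it by an edge to a vertex chosen uniformly at random from $\{1,\dots,n\}$, independently of the past. For a vertex $v$ of $T_n$ let $\mathcal{C}_{T_n}(v)=\sum_{u\neq v}\mathrm{dist}_{T_n}(v,u)$ be its closeness centrality, where smaller values mean more central. Rank the vertices of $T_n$ from most to least central, vertices with equal centrality being ordered in reverse order of insertion, that is, the one inserted later is ranked as more central. Let $R_n\in\{1,\dots,n\}$ be the rank of the root, so that $$R_n = 1+\bigl|\{v\in\{2,\dots,n\} : \mathcal{C}_{T_n}(v)\le \mathcal{C}_{T_n}(1)\}\bigr| .$$ Then $\mathbb{E} R_n=\exp\bigl(\Omega((\log n)^{1/3})\bigr)$; that is, there are absolute constants $c>0$ and $N$ such that for all integers $n\ge \max(N,1)$, $$\mathbb{E} R_n\ \ge\ \exp\bigl(c\,(\log n)^{1/3}\bigr).$$ -/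

import Mathlib

open MeasureTheory ProbabilityTheory

namespace URRT

/-- The tree on `n` vertices grown from the attachment choices `p`. Vertices are numbered from `0`
in order of arrival, so that `0` is the root, and for every `k` the vertex `k + 1` is, at its
arrival, joined by one edge to the vertex `p k` among the `k + 1` vertices `0, …, k` already
present. -/
def tree (p : ∀ k : ℕ, Fin (k + 1)) (n : ℕ) : SimpleGraph (Fin n) :=
  SimpleGraph.fromRel fun u v => ∃ k : ℕ, (v : ℕ) = k + 1 ∧ (u : ℕ) = (p k : ℕ)

/-- Uniform attachment: the choices are independent random variables, and the `k`-th one is uniform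
on the `k + 1` vertices present. The trees `tree (fun k => parent k ω) n`, for `n = 1, 2, …`, then
form the uniform random recursive tree process. -/
structure IsUniformAttachment {Ω : Type*} [MeasurableSpace Ω] (μ : Measure Ω)
    (parent : ∀ k : ℕ, Ω → Fin (k + 1)) : Prop where
  measurable : ∀ k, Measurable (parent k)
  indep : iIndepFun parent μ
  uniform : ∀ (k : ℕ) (i : Fin (k + 1)), μ {ω | parent k ω = i} = ((k : ENNReal) + 1)⁻¹

/-- Closeness centrality: the sum of the distances to all other vertices; smaller means more
central. -/
noncomputable def closeness {n : ℕ} (T : SimpleGraph (Fin n)) (v : Fin n) : ℕ :=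
  ∑ u ∈ Finset.univ.erase v, T.dist v u

/-- The rank of `v` when the vertices are ordered by increasing values of `ψ`, vertices with equal
values being ordered in reverse order of arrival. -/
def rank {n : ℕ} (ψ : Fin n → ℕ) (v : Fin n) : ℕ :=
  1 + (Finset.univ.filter fun u => ψ u < ψ v ∨ (ψ u = ψ v ∧ v < u)).card

/-- The closeness rank of the root in a tree with `n ≥ 1` vertices. -/
noncomputable def rootRank {n : ℕ} [NeZero n] (T : SimpleGraph (Fin n)) : ℕ :=
  rank (closeness T) 0

end URRT

namespace URRT

/-! The mean is forced up by a rare event. Take `d = 2j` and `l = 16j`, and suppose that `0, …, d`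
form a path and that all of `d, …, l` hang below `d`. This has probability at least `(16j)^(-2j)`.
On this event the vertices outside the subtree of `d` start with a share below `1/8`, and their
share then evolves as in a Pólya urn. While it is at most `1/4`, every vertex at depth `j` below `d`
is at least as central as the root: moving from the root to it gains at least `d - j` on each
descendant of `d` and loses at most `d + j` on each other vertex (`Below.closeness_le`). So the rank
of the root exceeds the size of that level. The level is large on average: each doubling of the tree
adds to level `h + 1` at least half of the mean size of level `h`, so after `t` doublings level `j`
has mean at least `choose t j / 2^j` times the probability of the event (`le_integral_levelCard`).
The share of outside vertices stays small even when weighted by the level size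
(`integral_levelCard_mul_outsideCard_le`), so at least half of this mean survives. Altogether the
mean rank is at least `(16j)^(-2j) * choose t j / 2^(j+1)`. Since `choose t j` is at least about
`(t/j)^j`, a large multiple of `j^3` suffices for `t` to make this at least `exp j`. Then `log n` is
of order `j^3`, whence the exponent `1/3`. -/

/-- `Below p d h v`: the vertex `v` is a descendant of `d`, at depth `h` below it. -/
inductive Below (p : ∀ k : ℕ, Fin (k + 1)) (d : ℕ) : ℕ → ℕ → Prop
  | base : Below p d 0 d
  | step {h k : ℕ} : Below p d h (p k) → Below p d (h + 1) (k + 1)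

/-- The depth of a vertex below the root. -/
def depth (p : ∀ k : ℕ, Fin (k + 1)) : ℕ → ℕ
  | 0 => 0
  | k + 1 => depth p (p k) + 1
decreasing_by exact (p k).isLt

/-! ### Descendants and depth. -/

section Combinatorics

variable {p q : ∀ k : ℕ, Fin (k + 1)} {d h v m k : ℕ}

theorem Below.le (hv : Below p d h v) : d ≤ v := by
  induction hv with
  | base => exact le_rfl
  | @step h k _ ih => have := (p k).isLt; omega

theorem below_zero_iff : Below p d 0 v ↔ v = d := by
  constructor
  · intro hv; cases hv; rfl
  · rintro rfl; exact .base

theorem below_succ_iff : Below p d (h + 1) (k + 1) ↔ Below p d h (p k) :=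
  ⟨fun hv => by cases hv; assumption, .step⟩

theorem exists_below_succ_iff (hk : d ≤ k) :
    (∃ h, Below p d h (k + 1)) ↔ ∃ h, Below p d h (p k) := by
  constructor
  · rintro ⟨h, hv⟩
    cases h with
    | zero => rw [below_zero_iff] at hv; omega
    | succ h => exact ⟨h, below_succ_iff.1 hv⟩
  · rintro ⟨h, hv⟩
    exact ⟨h + 1, hv.step⟩

theorem Below.congr (hpq : ∀ k < m, p k = q k) (hv : Below p d h v) (hm : v ≤ m) :
    Below q d h v := by
  induction hv with
  | base => exact .base
  | @step h k _ ih =>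
    have := (p k).isLt
    have ih := ih (by omega)
    rw [hpq k (by omega)] at ih
    exact ih.step

theorem below_congr (hpq : ∀ k < m, p k = q k) (hm : v ≤ m) :
    Below p d h v ↔ Below q d h v :=
  ⟨fun hv => hv.congr hpq hm, fun hv => hv.congr (fun k hk => (hpq k hk).symm) hm⟩

/-- Following parents from `v` never jumps over `d`, since a vertex later than `d` has its parent at
or after `d`; the labels decrease, so the path ends at `d`. -/
theorem exists_below_of_le {l : ℕ} (hI : ∀ k < l, min k d ≤ p k) (hv : d ≤ v) (hl : v ≤ l) :
    ∃ h, Below p d h v := by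
  induction v using Nat.strong_induction_on with
  | _ v ih =>
    rcases hv.eq_or_lt with rfl | hlt
    · exact ⟨0, .base⟩
    · obtain ⟨k, rfl⟩ : ∃ k, v = k + 1 := ⟨v - 1, by omega⟩
      have h1 := hI k (by omega)
      have h2 := (p k).isLt
      obtain ⟨h, hh⟩ := ih (p k) h2 (by omega) (by omega)
      exact ⟨h + 1, hh.step⟩

theorem depth_zero : depth p 0 = 0 := by rw [depth]

theorem depth_succ : depth p (k + 1) = depth p (p k) + 1 := by rw [depth]

theorem depth_eq_self (hI : ∀ k < d, k ≤ p k) : depth p d = d := by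
  induction d with
  | zero => exact depth_zero
  | succ d ih =>
    have h1 := hI d (by omega)
    have h2 := (p d).isLt
    have h3 : (p d : ℕ) = d := by omega
    rw [depth_succ, h3, ih fun k hk => hI k (by omega)]

theorem Below.depth_eq (hv : Below p d h v) : depth p v = depth p d + h := by
  induction hv with
  | base => rfl
  | step _ ih => rw [depth_succ, ih]; rfl

variable {n : ℕ}

/-! ### Graph distances against depth. -/

theorem tree_adj_parent (hk : k + 1 < n) :
    (tree p n).Adj ⟨p k, (p k).isLt.trans hk⟩ ⟨k + 1, hk⟩ := by
  rw [tree, SimpleGraph.fromRel_adj]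
  refine ⟨fun h => ?_, Or.inl ⟨k, rfl, rfl⟩⟩
  have := congrArg Fin.val h
  have := (p k).isLt
  simp only at *
  omega

theorem depth_le_of_adj {u v : Fin n} (huv : (tree p n).Adj u v) :
    depth p v ≤ depth p u + 1 := by
  rw [tree, SimpleGraph.fromRel_adj] at huv
  obtain ⟨-, ⟨k, h1, h2⟩ | ⟨k, h1, h2⟩⟩ := huv
  · rw [h1, h2, depth_succ]
  · rw [h1, h2, depth_succ]; omega

theorem depth_le_of_walk {u v : Fin n} (w : (tree p n).Walk u v) :
    depth p v ≤ depth p u + w.length := by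
  induction w with
  | nil => simp
  | cons hadj w ih =>
    have := depth_le_of_adj hadj
    rw [SimpleGraph.Walk.length_cons]
    omega

theorem tree_connected [NeZero n] : (tree p n).Connected := by
  have key : ∀ v (hv : v < n), (tree p n).Reachable 0 ⟨v, hv⟩ := by
    intro v
    induction v using Nat.strong_induction_on with
    | _ v ih =>
      intro hv
      cases v with
      | zero => exact SimpleGraph.Reachable.refl _
      | succ k => exact (ih (p k) (p k).isLt _).trans (tree_adj_parent hv).reachable
  exact SimpleGraph.connected_iff_exists_forall_reachable _ |>.2 ⟨0, fun v => key v v.isLt⟩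

/-- Depth changes by at most one along an edge, so a walk from the root needs at least `depth p v`
steps. -/
theorem depth_le_dist [NeZero n] (v : Fin n) : depth p v ≤ (tree p n).dist 0 v := by
  obtain ⟨w, hw⟩ := (tree_connected (p := p) (n := n)).exists_walk_length_eq_dist 0 v
  have := depth_le_of_walk w
  rw [hw] at this
  simpa [depth_zero] using this

theorem Below.dist_le [NeZero n] (hv : Below p d h v) (hn : v < n) :
    (tree p n).dist ⟨d, hv.le.trans_lt hn⟩ ⟨v, hn⟩ ≤ h := by
  induction hv with
  | base => simp
  | @step h k hk ih =>
    have h1 := ih ((p k).isLt.trans hn)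
    have h2 := SimpleGraph.dist_eq_one_iff_adj.2 (tree_adj_parent (p := p) hn)
    have h3 := (tree_connected (p := p) (n := n)).dist_triangle
      (u := ⟨d, hk.le.trans_lt ((p k).isLt.trans hn)⟩) (v := ⟨p k, (p k).isLt.trans hn⟩)
      (w := ⟨k + 1, hn⟩)
    omega

theorem dist_zero_le_depth [NeZero n] (hn : v < n) :
    (tree p n).dist 0 ⟨v, hn⟩ ≤ depth p v := by
  induction v using Nat.strong_induction_on with
  | _ v ih =>
    cases v with
    | zero => simp [show (⟨0, hn⟩ : Fin n) = 0 from rfl]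
    | succ k =>
      have h1 := ih (p k) (p k).isLt ((p k).isLt.trans hn)
      have h2 := SimpleGraph.dist_eq_one_iff_adj.2 (tree_adj_parent (p := p) hn)
      have h3 := (tree_connected (p := p) (n := n)).dist_triangle
        (u := 0) (v := ⟨p k, (p k).isLt.trans hn⟩) (w := ⟨k + 1, hn⟩)
      rw [depth_succ]
      omega

theorem closeness_eq_sum (T : SimpleGraph (Fin n)) (v : Fin n) :
    closeness T v = ∑ u, T.dist v u := by
  rw [closeness, ← Finset.add_sum_erase _ _ (Finset.mem_univ v), SimpleGraph.dist_self, zero_add]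

/-! ### Level sizes, outside vertices, and the rare event. -/

open Classical in
/-- The number of vertices among `0, …, m` at depth `h` below `d`. -/
noncomputable def levelCard (p : ∀ k : ℕ, Fin (k + 1)) (d h m : ℕ) : ℝ :=
  ∑ v : Fin (m + 1), if Below p d h v then 1 else 0

open Classical in
/-- The number of vertices among `0, …, m` that are not descendants of `d`. -/
noncomputable def outsideCard (p : ∀ k : ℕ, Fin (k + 1)) (d m : ℕ) : ℝ :=
  ∑ v : Fin (m + 1), if ∃ h, Below p d h v then 0 else 1

open Classical in
/-- The indicator of the event that `0, …, d` form a path and that the vertices `d, …, l` are all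
descendants of `d`. -/
noncomputable def spine (p : ∀ k : ℕ, Fin (k + 1)) (d l : ℕ) : ℝ :=
  if ∀ k < l, min k d ≤ p k then 1 else 0

theorem levelCard_nonneg : 0 ≤ levelCard p d h m :=
  Finset.sum_nonneg fun _ _ => by split_ifs <;> norm_num

theorem outsideCard_nonneg : 0 ≤ outsideCard p d m :=
  Finset.sum_nonneg fun _ _ => by split_ifs <;> norm_num

theorem spine_nonneg {l : ℕ} : 0 ≤ spine p d l := by
  unfold spine; split_ifs <;> norm_num

theorem levelCard_zero (hd : d ≤ m) : levelCard p d 0 m = 1 := by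
  classical
  have : ∀ v : Fin (m + 1), (if Below p d 0 v then (1 : ℝ) else 0) =
      if v = (⟨d, by omega⟩ : Fin (m + 1)) then 1 else 0 := by
    intro v; simp only [below_zero_iff, Fin.ext_iff]
  simp only [levelCard, this]
  simp

open Classical in
theorem levelCard_succ : levelCard p d (h + 1) (m + 1) =
    levelCard p d (h + 1) m + if Below p d h (p m) then 1 else 0 := by
  simp only [levelCard]
  rw [Fin.sum_univ_castSucc]
  simp [below_succ_iff]

open Classical in
theorem outsideCard_succ (hd : d ≤ m) : outsideCard p d (m + 1) =
    outsideCard p d m + if ∃ h, Below p d h (p m) then 0 else 1 := by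
  simp only [outsideCard]
  rw [Fin.sum_univ_castSucc]
  simp [exists_below_succ_iff hd]

theorem outsideCard_eq {l : ℕ} (hd : d ≤ l) (hI : ∀ k < l, min k d ≤ p k) :
    outsideCard p d l = d := by
  classical
  have : ∀ v : Fin (l + 1), (if ∃ h, Below p d h v then (0 : ℝ) else 1) =
      if (v : ℕ) < d then 1 else 0 := by
    intro v
    by_cases hv : (v : ℕ) < d
    · rw [if_pos hv, if_neg]
      rintro ⟨h, hb⟩
      exact absurd hb.le (by omega)
    · rw [if_neg hv, if_pos (exists_below_of_le hI (by omega) (by have := v.isLt; omega))]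
  simp only [outsideCard, this]
  rw [Fin.sum_univ_eq_sum_range (fun v => if v < d then (1 : ℝ) else 0), Finset.sum_boole]
  congr 1
  have : (Finset.range (l + 1)).filter (· < d) = Finset.range d := by
    ext x; simp; omega
  rw [this, Finset.card_range]

/-! ### From the shape of the tree to the rank of the root. -/

/-- If `d` is at depth `d` and the vertices that are not its descendants have proportion at most
`1/4`, then a vertex at depth `h ≤ d / 2` below `d` is at least as central as the root. -/
theorem Below.closeness_le (hI : ∀ k < d, k ≤ p k) (hX : 4 * outsideCard p d m ≤ m + 1)
    (hd : 2 * h ≤ d) (u : Fin (m + 1)) (hu : Below p d h u) :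
    closeness (tree p (m + 1)) u ≤ closeness (tree p (m + 1)) 0 := by
  classical
  have hdm : d < m + 1 := hu.le.trans_lt u.isLt
  set T := tree p (m + 1) with hT
  have hcon : T.Connected := tree_connected
  have h0d : T.dist 0 ⟨d, hdm⟩ ≤ d := by
    simpa [depth_eq_self hI] using dist_zero_le_depth (p := p) hdm
  -- Descendants of `d` gain `d - h`; for the others the detour through `d` and the root loses at
  -- most `d + h`, which is `2 * d` more than the common term `h - d`.
  have hw : ∀ w : Fin (m + 1), (T.dist u w : ℝ) + d ≤
      T.dist 0 w + h + 2 * d * if ∃ h, Below p d h w then 0 else 1 := by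
    intro w
    have h1 : T.dist ⟨d, hdm⟩ u ≤ h := hu.dist_le u.isLt
    have h2 := hcon.dist_triangle (u := u) (v := ⟨d, hdm⟩) (w := w)
    rw [SimpleGraph.dist_comm] at h1
    split_ifs with hb
    · obtain ⟨i, hi⟩ := hb
      have h3 : T.dist ⟨d, hdm⟩ w ≤ i := hi.dist_le w.isLt
      have h4 := hi.depth_eq
      rw [depth_eq_self hI] at h4
      have h5 : depth p w ≤ T.dist 0 w := depth_le_dist w
      have : T.dist u w + d ≤ T.dist 0 w + h := by omega
      simpa using (by exact_mod_cast this : (T.dist u w : ℝ) + d ≤ T.dist 0 w + h)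
    · have h3 := hcon.dist_triangle (u := ⟨d, hdm⟩) (v := 0) (w := w)
      rw [SimpleGraph.dist_comm] at h0d
      have : T.dist u w + d ≤ T.dist 0 w + h + 2 * d := by omega
      rw [mul_one]
      exact_mod_cast this
  have hsum := Finset.sum_le_sum fun w (_ : w ∈ Finset.univ) => hw w
  rw [Finset.sum_add_distrib, Finset.sum_add_distrib, Finset.sum_add_distrib,
    ← Finset.mul_sum] at hsum
  simp only [Finset.sum_const, Finset.card_univ, Fintype.card_fin, nsmul_eq_mul] at hsum
  change _ ≤ _ + _ + 2 * (d : ℝ) * outsideCard p d m at hsum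
  have hd' : 2 * (h : ℝ) ≤ d := by exact_mod_cast hd
  have h5 : 2 * (d : ℝ) * outsideCard p d m ≤ d * ((m + 1) / 2) := by
    have := mul_le_mul_of_nonneg_left hX (Nat.cast_nonneg (α := ℝ) d)
    nlinarith
  have h6 : ((m : ℝ) + 1) * h ≤ (m + 1) * (d / 2) := by gcongr; linarith
  rw [closeness_eq_sum, closeness_eq_sum]
  have : (∑ w, (T.dist u w : ℝ)) ≤ ∑ w, (T.dist 0 w : ℝ) := by
    push_cast at hsum
    nlinarith
  exact_mod_cast this

/-- The factor `1 - 4X/(m+1)`, with `X` the number of outside vertices, is a linear minorant of the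
indicator of `4X ≤ m + 1`; being linear in `X`, it can be averaged using mixed first moments only.
-/
theorem le_rootRank {l : ℕ} (hd0 : 0 < d) (hdl : d ≤ l) (hd : 2 * h ≤ d) :
    spine p d l * levelCard p d h m * (1 - 4 / (m + 1) * outsideCard p d m) ≤
      rootRank (tree p (m + 1)) := by
  classical
  have hm : (0 : ℝ) < m + 1 := by positivity
  by_cases hI : ∀ k < l, min k d ≤ p k
  swap
  · rw [spine, if_neg hI, zero_mul, zero_mul]
    exact Nat.cast_nonneg _
  by_cases hX : 4 * outsideCard p d m ≤ m + 1
  swap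
  · refine le_trans (mul_nonpos_of_nonneg_of_nonpos
      (mul_nonneg spine_nonneg levelCard_nonneg) ?_) (Nat.cast_nonneg _)
    rw [div_mul_eq_mul_div, sub_nonpos, le_div_iff₀ hm]
    linarith
  have h1 : spine p d l * levelCard p d h m * (1 - 4 / (m + 1) * outsideCard p d m) ≤
      levelCard p d h m := by
    rw [spine, if_pos hI, one_mul]
    refine mul_le_of_le_one_right levelCard_nonneg ?_
    have := mul_nonneg (div_nonneg (by norm_num : (0 : ℝ) ≤ 4) hm.le)
      (outsideCard_nonneg (p := p) (d := d) (m := m))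
    linarith
  refine h1.trans ?_
  rw [levelCard, Finset.sum_boole, rootRank, rank]
  norm_cast
  refine le_trans (Finset.card_le_card fun u hu => ?_) (Nat.le_add_left _ _)
  have hu := (Finset.mem_filter.1 hu).2
  have hle := hu.closeness_le (fun k hk => by have := hI k (by omega); omega) hX hd
  -- Ties count as well: a later vertex is ranked ahead of the root.
  have hpos : (0 : Fin (m + 1)) < u := by
    rw [Fin.lt_def]; exact hd0.trans_le hu.le
  exact Finset.mem_filter.2 ⟨Finset.mem_univ _, hle.lt_or_eq.imp_right fun h => ⟨h, hpos⟩⟩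

end Combinatorics

/-! ### Quantities determined by the first `m` choices. -/

section Dependence

variable {d h m l : ℕ}

theorem dependsOn_levelCard : DependsOn (fun p => levelCard p d h m) (Set.Iio m) := by
  classical
  intro p q hpq
  refine Finset.sum_congr rfl fun v _ => ?_
  simp only [below_congr hpq (Nat.lt_succ_iff.1 v.isLt)]

theorem dependsOn_outsideCard : DependsOn (fun p => outsideCard p d m) (Set.Iio m) := by
  classical
  intro p q hpq
  refine Finset.sum_congr rfl fun v _ => ?_
  simp only [below_congr hpq (Nat.lt_succ_iff.1 v.isLt)]

theorem dependsOn_spine (hl : l ≤ m) : DependsOn (fun p => spine p d l) (Set.Iio m) := by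
  classical
  intro p q hpq
  have : (∀ k < l, min k d ≤ p k) ↔ ∀ k < l, min k d ≤ q k :=
    forall₂_congr fun k hk => by rw [hpq k (hk.trans_le hl)]
  simp only [spine, this]

theorem dependsOn_tree : DependsOn (fun p => tree p (m + 1)) (Set.Iio m) := by
  intro p q hpq
  ext u v
  simp only [tree, SimpleGraph.fromRel_adj]
  have key : ∀ u v : Fin (m + 1), (∃ k : ℕ, (v : ℕ) = k + 1 ∧ (u : ℕ) = (p k : ℕ)) ↔
      ∃ k : ℕ, (v : ℕ) = k + 1 ∧ (u : ℕ) = (q k : ℕ) := fun u v =>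
    exists_congr fun k => and_congr_right fun hk => by
      rw [hpq k (show k < m by have := v.isLt; omega)]
  rw [key u v, key v u]

theorem dependsOn_mul {ι : Type*} {π : ι → Type*} {s : Set ι} {f g : (∀ i, π i) → ℝ}
    (hf : DependsOn f s) (hg : DependsOn g s) : DependsOn (fun p => f p * g p) s :=
  fun p q hpq => by simp only [hf hpq, hg hpq]

end Dependence

namespace IsUniformAttachment

variable {Ω : Type*} [MeasurableSpace Ω] {μ : Measure Ω}
  {parent : ∀ k : ℕ, Ω → Fin (k + 1)} {d h m l : ℕ}

/-! ### Averaging over independent uniform choices. -/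

/-- The first `m` choices range over a finite space, on which measurability and integrability are
automatic. -/
theorem exists_factor {F : (∀ k : ℕ, Fin (k + 1)) → ℝ} (hF : DependsOn F (Set.Iio m)) :
    ∃ g : (∀ k : Finset.range m, Fin ((k : ℕ) + 1)) → ℝ, ∀ p, F p = g fun k => p k := by
  refine ⟨fun q => F fun k => if hk : k ∈ Finset.range m then q ⟨k, hk⟩ else 0, fun p => ?_⟩
  refine hF fun k hk => ?_
  rw [dif_pos (Finset.mem_range.2 hk)]

theorem integrable [IsProbabilityMeasure μ]
    (hP : IsUniformAttachment μ parent) {F : (∀ k : ℕ, Fin (k + 1)) → ℝ}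
    (hF : DependsOn F (Set.Iio m)) : Integrable (fun ω => F fun k => parent k ω) μ := by
  obtain ⟨g, hg⟩ := exists_factor hF
  simp only [hg]
  have hmeas : Measurable fun ω => fun k : Finset.range m => parent k ω :=
    measurable_pi_lambda _ fun k => hP.measurable k
  have := Measure.isProbabilityMeasure_map (μ := μ) hmeas.aemeasurable
  exact (Integrable.of_finite (f := g)).comp_measurable hmeas

theorem integral_mul_indicator (hP : IsUniformAttachment μ parent)
    {F : (∀ k : ℕ, Fin (k + 1)) → ℝ} (hF : DependsOn F (Set.Iio m)) (i : Fin (m + 1)) :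
    ∫ ω, F (fun k => parent k ω) * (if parent m ω = i then 1 else 0) ∂μ =
      (∫ ω, F fun k => parent k ω ∂μ) / (m + 1) := by
  obtain ⟨g, hg⟩ := exists_factor hF
  simp only [hg]
  have hind := (hP.indep.indepFun_finset (Finset.range m) {m} (by simp) hP.measurable).comp
    (φ := g) (ψ := fun q => if q ⟨m, Finset.mem_singleton_self m⟩ = i then (1 : ℝ) else 0)
    (Measurable.of_discrete) (Measurable.of_discrete)
  have hmeas : Measurable fun ω => fun k : Finset.range m => parent k ω :=
    measurable_pi_lambda _ fun k => hP.measurable k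
  have hmeas' : Measurable fun ω => if parent m ω = i then (1 : ℝ) else 0 :=
    (Measurable.of_discrete (f := fun x : Fin (m + 1) => if x = i then (1 : ℝ) else 0)).comp
      (hP.measurable m)
  have h1 := hind.integral_fun_mul_eq_mul_integral
    ((Measurable.of_discrete (f := g)).comp hmeas).aestronglyMeasurable
    hmeas'.aestronglyMeasurable
  simp only [Function.comp_def] at h1
  rw [h1, div_eq_mul_inv]
  congr 1
  have hset : MeasurableSet {ω | parent m ω = i} := hP.measurable m (measurableSet_singleton i)
  have h2 : (fun ω => if parent m ω = i then (1 : ℝ) else 0) =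
      Set.indicator {ω | parent m ω = i} 1 := by
    ext ω; simp [Set.indicator_apply]
  rw [h2, integral_indicator_one hset, Measure.real, hP.uniform]
  rw [ENNReal.toReal_inv]
  norm_cast

/-- Averaging over the choice of the last parent. -/
theorem integral_step [IsProbabilityMeasure μ]
    (hP : IsUniformAttachment μ parent)
    {F : (∀ k : ℕ, Fin (k + 1)) → Fin (m + 1) → ℝ}
    (hF : ∀ i, DependsOn (fun p => F p i) (Set.Iio m)) :
    ∫ ω, F (fun k => parent k ω) (parent m ω) ∂μ =
      (∫ ω, ∑ i, F (fun k => parent k ω) i ∂μ) / (m + 1) := by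
  have h1 : ∀ ω, F (fun k => parent k ω) (parent m ω) =
      ∑ i, F (fun k => parent k ω) i * if parent m ω = i then 1 else 0 := by
    intro ω; simp
  have hint : ∀ i, Integrable
      (fun ω => F (fun k => parent k ω) i * if parent m ω = i then 1 else 0) μ := by
    intro i
    refine hP.integrable (m := m + 1) (F := fun p => F p i * if p m = i then 1 else 0) ?_
    intro p q hpq
    have h2 := hF i (fun k (hk : k < m) => hpq k (hk.trans (Nat.lt_succ_self m)))
    simp only at h2
    simp only [h2, hpq m (Nat.lt_succ_self m)]
  simp only [h1]
  rw [integral_finsetSum _ fun i _ => hint i,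
    integral_finsetSum _ fun i _ => hP.integrable (hF i), Finset.sum_div]
  exact Finset.sum_congr rfl fun i _ => hP.integral_mul_indicator (hF i) i

/-- Choice `k` succeeds with probability `(k + 1 - min k d) / (k + 1)`, independently of the others.
For `l ≤ d` truncated subtraction correctly leaves the numerator `0! = 1`. -/
theorem integral_spine [IsProbabilityMeasure μ]
    (hP : IsUniformAttachment μ parent) (d l : ℕ) :
    ∫ ω, spine (fun k => parent k ω) d l ∂μ = ((l - d).factorial : ℝ) / l.factorial := by
  classical
  induction l with
  | zero => simp [spine]
  | succ l ih =>
    have h1 : ∀ p : ∀ k : ℕ, Fin (k + 1), spine p d (l + 1) =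
        spine p d l * if min l d ≤ p l then 1 else 0 := by
      intro p
      simp only [spine, Nat.lt_succ_iff_lt_or_eq, or_imp, forall_and, forall_eq]
      split_ifs <;> simp_all
    simp only [h1]
    have h2 : (∑ i : Fin (l + 1), if min l d ≤ i then (1 : ℝ) else 0) =
        ((l + 1 - min l d : ℕ) : ℝ) := by
      rw [Fin.sum_univ_eq_sum_range (fun i => if min l d ≤ i then (1 : ℝ) else 0),
        Finset.sum_boole]
      have : (Finset.range (l + 1)).filter (min l d ≤ ·) = Finset.Ico (min l d) (l + 1) := by
        ext x; simp; omega
      rw [this, Nat.card_Ico]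
    rw [hP.integral_step
      (F := fun p (i : Fin (l + 1)) => spine p d l * if min l d ≤ i then 1 else 0)
      fun i p q hpq => by
        have := dependsOn_spine (d := d) (le_refl l) hpq
        simp only at this
        simp only [this]]
    simp only [← Finset.mul_sum, h2]
    rw [integral_mul_const, ih, Nat.factorial_succ]
    have hl : (l.factorial : ℝ) ≠ 0 := by positivity
    have hl' : (l : ℝ) + 1 ≠ 0 := by positivity
    rcases lt_or_ge l d with hld | hld
    · rw [min_eq_left hld.le, Nat.sub_eq_zero_of_le hld.le, Nat.sub_eq_zero_of_le hld]
      push_cast [Nat.add_sub_cancel_left]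
      field_simp
    · rw [min_eq_right hld, Nat.sub_add_comm hld, Nat.factorial_succ]
      push_cast
      field_simp

theorem le_integral_spine [IsProbabilityMeasure μ]
    (hP : IsUniformAttachment μ parent) (hdl : d ≤ l) :
    (((l : ℝ) ^ d)⁻¹) ≤ ∫ ω, spine (fun k => parent k ω) d l ∂μ := by
  rw [hP.integral_spine, ← Nat.factorial_mul_descFactorial hdl]
  have h1 : ((l - d).factorial : ℝ) ≠ 0 := by positivity
  have h2 : 0 < (l.descFactorial d : ℝ) := by
    exact_mod_cast Nat.pos_of_ne_zero fun h => by
      rw [Nat.descFactorial_eq_zero_iff_lt] at h; omega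
  push_cast
  rw [div_mul_cancel_left₀ h1]
  gcongr
  exact_mod_cast Nat.descFactorial_le_pow l d

/-! ### One-step recursions for level sizes and outside vertices. -/

theorem integral_levelCard_zero (hdm : d ≤ m) :
    ∫ ω, spine (fun k => parent k ω) d l * levelCard (fun k => parent k ω) d 0 m ∂μ =
      ∫ ω, spine (fun k => parent k ω) d l ∂μ := by
  simp only [levelCard_zero hdm, mul_one]

theorem integral_levelCard_succ [IsProbabilityMeasure μ]
    (hP : IsUniformAttachment μ parent) (hlm : l ≤ m) :
    ∫ ω, spine (fun k => parent k ω) d l *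
        levelCard (fun k => parent k ω) d (h + 1) (m + 1) ∂μ =
      ∫ ω, spine (fun k => parent k ω) d l * levelCard (fun k => parent k ω) d (h + 1) m ∂μ +
      (∫ ω, spine (fun k => parent k ω) d l * levelCard (fun k => parent k ω) d h m ∂μ) /
        (m + 1) := by
  classical
  have hdep : ∀ i : Fin (m + 1), DependsOn
      (fun p => spine p d l * if Below p d h i then 1 else 0) (Set.Iio m) := fun i p q hpq => by
    have h1 := dependsOn_spine (d := d) hlm hpq
    simp only at h1
    simp only [h1, below_congr hpq (Nat.lt_succ_iff.1 i.isLt)]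
  have hint := hP.integrable (dependsOn_mul (dependsOn_spine (d := d) hlm)
    (dependsOn_levelCard (d := d) (h := h + 1)))
  have h1 := hP.integral_step hdep
  simp only [← Finset.mul_sum] at h1
  change _ = (∫ ω, _ * levelCard _ d h m ∂μ) / _ at h1
  simp only [levelCard_succ, mul_add]
  rw [← h1, integral_add hint]
  refine hP.integrable (m := m + 1)
    (F := fun p => spine p d l * if Below p d h (p m) then 1 else 0) fun p q hpq => ?_
  have h1 := dependsOn_spine (d := d) (hlm.trans (Nat.le_succ m)) hpq
  simp only at h1
  simp only
  rw [h1, hpq m (Nat.lt_succ_self m), below_congr (m := m + 1) hpq (q m).isLt.le]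

theorem integral_levelCard_mul_outsideCard_zero [IsProbabilityMeasure μ]
    (hP : IsUniformAttachment μ parent)
    (hlm : l ≤ m) (hdm : d ≤ m) :
    ∫ ω, spine (fun k => parent k ω) d l * levelCard (fun k => parent k ω) d 0 (m + 1) *
        outsideCard (fun k => parent k ω) d (m + 1) ∂μ =
      (∫ ω, spine (fun k => parent k ω) d l * levelCard (fun k => parent k ω) d 0 m *
        outsideCard (fun k => parent k ω) d m ∂μ) * ((m + 2) / (m + 1)) := by
  classical
  simp only [levelCard_zero hdm, levelCard_zero (hdm.trans (Nat.le_succ m)), mul_one,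
    outsideCard_succ hdm]
  have h1 := hP.integral_step (m := m) (F := fun p i => spine p d l * (outsideCard p d m +
    if ∃ h, Below p d h i then 0 else 1)) fun i p q hpq => by
      have h1 := dependsOn_spine (d := d) hlm hpq
      have h2 := dependsOn_outsideCard (d := d) hpq
      simp only at h1 h2
      simp only [h1, h2, below_congr hpq (Nat.lt_succ_iff.1 i.isLt)]
  have h2 : ∀ p, (∑ i : Fin (m + 1), spine p d l * (outsideCard p d m +
      if ∃ h, Below p d h i then 0 else 1)) = spine p d l * outsideCard p d m * (m + 2) := by
    intro p
    rw [← Finset.mul_sum, Finset.sum_add_distrib]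
    change _ * (_ + outsideCard p d m) = _
    simp
    ring
  simp only [h2] at h1
  rw [h1, integral_mul_const, mul_div_assoc]

/-- A new vertex is never both on a level below `d` and outside, so the product of the two
increments vanishes and no quadratic term appears. -/
theorem integral_levelCard_mul_outsideCard_succ [IsProbabilityMeasure μ]
    (hP : IsUniformAttachment μ parent)
    (hlm : l ≤ m) (hdm : d ≤ m) :
    ∫ ω, spine (fun k => parent k ω) d l * levelCard (fun k => parent k ω) d (h + 1) (m + 1) *
        outsideCard (fun k => parent k ω) d (m + 1) ∂μ =
      (∫ ω, spine (fun k => parent k ω) d l * levelCard (fun k => parent k ω) d (h + 1) m *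
        outsideCard (fun k => parent k ω) d m ∂μ) * ((m + 2) / (m + 1)) +
      (∫ ω, spine (fun k => parent k ω) d l * levelCard (fun k => parent k ω) d h m *
        outsideCard (fun k => parent k ω) d m ∂μ) / (m + 1) := by
  classical
  simp only [levelCard_succ, outsideCard_succ hdm]
  have h1 := hP.integral_step (m := m) (F := fun p i => spine p d l *
    (levelCard p d (h + 1) m + if Below p d h i then 1 else 0) * (outsideCard p d m +
    if ∃ h, Below p d h i then 0 else 1)) fun i p q hpq => by
      have h1 := dependsOn_spine (d := d) hlm hpq
      have h2 := dependsOn_outsideCard (d := d) hpq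
      have h3 := dependsOn_levelCard (d := d) (h := h + 1) hpq
      simp only at h1 h2 h3
      simp only [h1, h2, h3, below_congr hpq (Nat.lt_succ_iff.1 i.isLt)]
  have h2 : ∀ p, (∑ i : Fin (m + 1), spine p d l *
      (levelCard p d (h + 1) m + if Below p d h i then 1 else 0) * (outsideCard p d m +
      if ∃ h, Below p d h i then 0 else 1)) =
      spine p d l * levelCard p d (h + 1) m * outsideCard p d m * (m + 2) +
      spine p d l * levelCard p d h m * outsideCard p d m := by
    intro p
    have h3 : ∀ i : Fin (m + 1), spine p d l *
      (levelCard p d (h + 1) m + if Below p d h i then 1 else 0) * (outsideCard p d m +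
      if ∃ h, Below p d h i then 0 else 1) =
      spine p d l * levelCard p d (h + 1) m * outsideCard p d m +
      spine p d l * levelCard p d (h + 1) m * (if ∃ h, Below p d h i then 0 else 1) +
      spine p d l * outsideCard p d m * (if Below p d h i then 1 else 0) := by
      intro i
      by_cases hb : Below p d h i
      · rw [if_pos hb, if_pos ⟨h, hb⟩]; ring
      · rw [if_neg hb]; ring
    simp only [h3]
    rw [Finset.sum_add_distrib, Finset.sum_add_distrib,
      ← Finset.mul_sum (f := fun i : Fin (m + 1) => if ∃ h, Below p d h i then (0 : ℝ) else 1), ← Finset.mul_sum (f := fun i : Fin (m + 1) =>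
      if Below p d h i then (1 : ℝ) else 0)]
    change _ + _ * outsideCard p d m + _ * levelCard p d h m = _
    simp
    ring
  simp only [h2] at h1
  have hint : ∀ i, Integrable (fun ω => spine (fun k => parent k ω) d l *
      levelCard (fun k => parent k ω) d i m * outsideCard (fun k => parent k ω) d m) μ :=
    fun i => hP.integrable (dependsOn_mul (dependsOn_mul (dependsOn_spine (d := d) hlm)
      (dependsOn_levelCard (d := d) (h := i))) (dependsOn_outsideCard (d := d)))
  rw [h1, integral_add ((hint _).mul_const _) (hint _), integral_mul_const]
  ring

/-- The proportion of vertices outside the descendants of `d` is, on average and weighted by the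
number of vertices on a level below `d`, at most what it was initially. -/
theorem integral_levelCard_mul_outsideCard_le [IsProbabilityMeasure μ]
    (hP : IsUniformAttachment μ parent)
    (hdl : d ≤ l) (hlm : l ≤ m) (h : ℕ) :
    ∫ ω, spine (fun k => parent k ω) d l * levelCard (fun k => parent k ω) d h m *
        outsideCard (fun k => parent k ω) d m ∂μ ≤
      (m + 1) * (d / (l + 1) *
        ∫ ω, spine (fun k => parent k ω) d l * levelCard (fun k => parent k ω) d h m ∂μ) := by
  induction m, hlm using Nat.le_induction generalizing h with
  | base =>
    have hl : (l : ℝ) + 1 ≠ 0 := by positivity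
    rw [← mul_assoc, mul_div_cancel₀ _ hl, ← integral_const_mul]
    refine le_of_eq (integral_congr_ae (.of_forall fun ω => ?_))
    simp only
    by_cases hI : ∀ k < l, min k d ≤ parent k ω
    · rw [outsideCard_eq hdl hI]; ring
    · rw [spine, if_neg hI]; ring
  | succ m hlm ih =>
    have hm : (0 : ℝ) < m + 1 := by positivity
    cases h with
    | zero =>
      have ih := ih 0
      rw [integral_levelCard_zero (hdl.trans hlm)] at ih
      rw [hP.integral_levelCard_mul_outsideCard_zero hlm (hdl.trans hlm),
        integral_levelCard_zero (by omega)]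
      have := mul_le_mul_of_nonneg_right ih (by positivity : (0 : ℝ) ≤ (m + 2) / (m + 1))
      refine this.trans (le_of_eq ?_)
      push_cast
      field_simp
      ring
    | succ h =>
      rw [hP.integral_levelCard_mul_outsideCard_succ hlm (hdl.trans hlm),
        hP.integral_levelCard_succ hlm]
      have h1 := mul_le_mul_of_nonneg_right (ih (h + 1))
        (by positivity : (0 : ℝ) ≤ (m + 2) / (m + 1))
      have h2 := div_le_div_of_nonneg_right (ih h) hm.le
      have h3 : 0 ≤ (d : ℝ) / (l + 1) * ∫ ω, spine (fun k => parent k ω) d l *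
          levelCard (fun k => parent k ω) d h m ∂μ :=
        mul_nonneg (by positivity) (integral_nonneg fun ω => mul_nonneg spine_nonneg
          levelCard_nonneg)
      refine (add_le_add h1 h2).trans ?_
      rw [mul_div_cancel_left₀ _ hm.ne']
      generalize (∫ ω, spine (fun k => parent k ω) d l *
          levelCard (fun k => parent k ω) d h m ∂μ) = a at *
      generalize (∫ ω, spine (fun k => parent k ω) d l *
          levelCard (fun k => parent k ω) d (h + 1) m ∂μ) = b at *
      push_cast
      generalize (d : ℝ) / (l + 1) = r at *
      -- The target exceeds the bound given by induction by the nonnegative term `r * a / (m + 1)`.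
      have h4 : ((m : ℝ) + 1 + 1) * (r * (b + a / (m + 1))) =
        (m + 1) * (r * b) * ((m + 2) / (m + 1)) + r * a + r * a / (m + 1) := by
        field_simp; ring
      rw [h4]
      have := div_nonneg h3 hm.le
      linarith

/-! ### Growth of the levels under doubling. -/

theorem integral_levelCard_mono [IsProbabilityMeasure μ]
    (hP : IsUniformAttachment μ parent) {m' : ℕ} (hlm : l ≤ m)
    (hm : m ≤ m') (hdl : d ≤ l) (h : ℕ) :
    ∫ ω, spine (fun k => parent k ω) d l * levelCard (fun k => parent k ω) d h m ∂μ ≤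
      ∫ ω, spine (fun k => parent k ω) d l * levelCard (fun k => parent k ω) d h m' ∂μ := by
  induction m', hm using Nat.le_induction with
  | base => exact le_rfl
  | succ m' hm ih =>
    refine ih.trans ?_
    cases h with
    | zero => rw [integral_levelCard_zero (by omega), integral_levelCard_zero (by omega)]
    | succ h =>
      rw [hP.integral_levelCard_succ (hlm.trans hm)]
      refine le_add_of_nonneg_right (div_nonneg (integral_nonneg fun ω =>
        mul_nonneg spine_nonneg levelCard_nonneg) (by positivity))

/-- For the next `m + 1` arrivals the tree to attach to has at most `2 * (m + 1)` vertices, and the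
mean of level `h` does not decrease. -/
theorem integral_levelCard_add [IsProbabilityMeasure μ]
    (hP : IsUniformAttachment μ parent) {i : ℕ} (hlm : l ≤ m)
    (hi : i ≤ m + 1) (hdl : d ≤ l) (h : ℕ) :
    ∫ ω, spine (fun k => parent k ω) d l * levelCard (fun k => parent k ω) d (h + 1) m ∂μ +
      i * ((∫ ω, spine (fun k => parent k ω) d l * levelCard (fun k => parent k ω) d h m ∂μ) /
        (2 * (m + 1))) ≤
      ∫ ω, spine (fun k => parent k ω) d l *
        levelCard (fun k => parent k ω) d (h + 1) (m + i) ∂μ := by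
  induction i with
  | zero => simp
  | succ i ih =>
    rw [← add_assoc m i 1, hP.integral_levelCard_succ (by omega : l ≤ m + i)]
    have h1 := ih (by omega)
    have h0 : 0 ≤ ∫ ω, spine (fun k => parent k ω) d l *
        levelCard (fun k => parent k ω) d h m ∂μ :=
      integral_nonneg fun ω => mul_nonneg spine_nonneg levelCard_nonneg
    have h2 := hP.integral_levelCard_mono hlm (Nat.le_add_right m i) hdl h
    have hi' : (i : ℝ) + 1 ≤ m + 1 := by exact_mod_cast hi
    have h3 : (∫ ω, spine (fun k => parent k ω) d l *
        levelCard (fun k => parent k ω) d h m ∂μ) / (2 * (m + 1)) ≤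
        (∫ ω, spine (fun k => parent k ω) d l *
        levelCard (fun k => parent k ω) d h (m + i) ∂μ) / ((m + i : ℕ) + 1) := by
      apply div_le_div₀ (h0.trans h2) h2 (by positivity)
      push_cast; linarith
    push_cast at h3 ⊢
    linarith

/-- Each doubling of the number of vertices contributes like a step of Pascal's triangle. -/
theorem le_integral_levelCard [IsProbabilityMeasure μ]
    (hP : IsUniformAttachment μ parent) (hdl : d ≤ l) (t h : ℕ)
    (hm : (l + 1) * 2 ^ t ≤ m + 1) :
    (∫ ω, spine (fun k => parent k ω) d l ∂μ) * (t.choose h / 2 ^ h) ≤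
      ∫ ω, spine (fun k => parent k ω) d l * levelCard (fun k => parent k ω) d h m ∂μ := by
  have hs : 0 ≤ ∫ ω, spine (fun k => parent k ω) d l ∂μ := integral_nonneg fun ω => spine_nonneg
  induction t generalizing h m with
  | zero =>
    cases h with
    | zero =>
      rw [integral_levelCard_zero (by simp at hm; omega)]; simp
    | succ h =>
      simp only [Nat.choose_zero_succ, Nat.cast_zero, zero_div, mul_zero]
      exact integral_nonneg fun ω => mul_nonneg spine_nonneg levelCard_nonneg
  | succ t ih =>
    cases h with
    | zero =>
      rw [integral_levelCard_zero]
      · simp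
      · have : 1 ≤ 2 ^ (t + 1) := Nat.one_le_two_pow
        nlinarith
    | succ h =>
      -- The vertices `0, …, a` make up exactly `t` doublings of `l + 1`; the next doubling adds `a
      -- + 1` vertices.
      obtain ⟨a, ha⟩ : ∃ a, (l + 1) * 2 ^ t = a + 1 :=
        ⟨_, (Nat.sub_add_cancel (by positivity : 0 < (l + 1) * 2 ^ t)).symm⟩
      have hla : l ≤ a := by
        have : 1 ≤ 2 ^ t := Nat.one_le_two_pow
        nlinarith
      have ham : a + (a + 1) ≤ m := by
        rw [pow_succ, ← mul_assoc, ha] at hm; omega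
      have h1 := hP.integral_levelCard_mono (m := a + (a + 1)) (by omega) ham hdl (h + 1)
      have h2 := hP.integral_levelCard_add hla le_rfl hdl h
      have h3 := ih h ha.le
      have h4 := ih (h + 1) ha.le
      refine le_trans ?_ h1
      refine le_trans ?_ h2
      have ha' : (a : ℝ) + 1 ≠ 0 := by positivity
      have h5 : ∀ x : ℝ, ((a + 1 : ℕ) : ℝ) * (x / (2 * (a + 1))) = x / 2 := by
        intro x; push_cast; field_simp
      rw [h5, Nat.choose_succ_succ]
      push_cast
      have h6 : (∫ ω, spine (fun k => parent k ω) d l ∂μ) *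
          (((t.choose h : ℝ) + t.choose (h + 1)) / 2 ^ (h + 1)) =
          (∫ ω, spine (fun k => parent k ω) d l ∂μ) * (t.choose (h + 1) / 2 ^ (h + 1)) +
          (∫ ω, spine (fun k => parent k ω) d l ∂μ) * (t.choose h / 2 ^ h) / 2 := by
        rw [pow_succ]; field_simp; ring
      rw [h6]
      linarith

/-- With `d = 2j`, level `j` is the deepest one allowed by `2 * h ≤ d`; with `l = 16j`, the
correction term costs at most half of the mean level size. -/
theorem le_integral_rootRank [IsProbabilityMeasure μ]
    (hP : IsUniformAttachment μ parent) {j t : ℕ} (hj : 0 < j)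
    (hm : (16 * j + 1) * 2 ^ t ≤ m + 1) :
    (((16 * j : ℕ) : ℝ) ^ (2 * j))⁻¹ * (t.choose j / 2 ^ j) / 2 ≤
      ∫ ω, (rootRank (tree (fun k => parent k ω) (m + 1)) : ℝ) ∂μ := by
  have hlm : 16 * j ≤ m := by
    have : 1 ≤ 2 ^ t := Nat.one_le_two_pow
    nlinarith
  have hdl : 2 * j ≤ 16 * j := by omega
  have hI : Integrable (fun ω => spine (fun k => parent k ω) (2 * j) (16 * j) *
      levelCard (fun k => parent k ω) (2 * j) j m) μ :=
    hP.integrable (dependsOn_mul (dependsOn_spine hlm) dependsOn_levelCard)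
  have hIX : Integrable (fun ω => spine (fun k => parent k ω) (2 * j) (16 * j) *
      levelCard (fun k => parent k ω) (2 * j) j m * outsideCard (fun k => parent k ω) (2 * j) m)
      μ :=
    hP.integrable (dependsOn_mul (dependsOn_mul (dependsOn_spine hlm) dependsOn_levelCard)
      dependsOn_outsideCard)
  have hR : Integrable (fun ω => (rootRank (tree (fun k => parent k ω) (m + 1)) : ℝ)) μ :=
    hP.integrable (F := fun p => (rootRank (tree p (m + 1)) : ℝ)) (m := m) fun p q hpq => by
      have := dependsOn_tree hpq
      simp only at this
      simp only [this]
  have h1 := integral_mono (hI.sub (hIX.const_mul (4 / (m + 1)))) hR fun ω => by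
    refine le_trans (le_of_eq ?_) (le_rootRank (p := fun k => parent k ω) (d := 2 * j)
      (l := 16 * j) (h := j) (m := m) (by omega) hdl le_rfl)
    simp only [Pi.sub_apply]
    ring
  simp only [Pi.sub_apply] at h1
  rw [integral_sub hI (hIX.const_mul _), integral_const_mul] at h1
  have h2 := hP.integral_levelCard_mul_outsideCard_le hdl hlm j
  have h3 := hP.le_integral_levelCard hdl t j hm
  have h4 := mul_le_mul_of_nonneg_right (hP.le_integral_spine hdl)
    (by positivity : (0 : ℝ) ≤ t.choose j / 2 ^ j)
  have h0 : 0 ≤ ∫ ω, spine (fun k => parent k ω) (2 * j) (16 * j) *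
      levelCard (fun k => parent k ω) (2 * j) j m ∂μ :=
    integral_nonneg fun ω => mul_nonneg spine_nonneg levelCard_nonneg
  generalize (∫ ω, spine (fun k => parent k ω) (2 * j) (16 * j) *
      levelCard (fun k => parent k ω) (2 * j) j m ∂μ) = z at *
  have hm0 : (0 : ℝ) < m + 1 := by positivity
  have h5 : 4 / ((m : ℝ) + 1) * ∫ ω, spine (fun k => parent k ω) (2 * j) (16 * j) *
      levelCard (fun k => parent k ω) (2 * j) j m *
      outsideCard (fun k => parent k ω) (2 * j) m ∂μ ≤ z / 2 := by
    refine (mul_le_mul_of_nonneg_left h2 (by positivity)).trans ?_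
    have h6 : ((2 * j : ℕ) : ℝ) / ((16 * j : ℕ) + 1) ≤ 1 / 8 := by
      rw [div_le_div_iff₀ (by positivity) (by norm_num)]
      push_cast; linarith
    have h7 := mul_le_mul_of_nonneg_right h6 h0
    have h8 : 4 / ((m : ℝ) + 1) * ((m + 1) * (((2 * j : ℕ) : ℝ) / ((16 * j : ℕ) + 1) * z)) =
        4 * (((2 * j : ℕ) : ℝ) / ((16 * j : ℕ) + 1) * z) := by
      field_simp
    rw [h8]
    linarith
  linarith

end IsUniformAttachment

/-! ### Numerical choice of the parameters. -/

theorem exp_le_choose_bound {j : ℕ} (hj : 0 < j) :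
    Real.exp j ≤ (((16 * j : ℕ) : ℝ) ^ (2 * j))⁻¹ * ((8192 * j ^ 3).choose j / 2 ^ j) / 2 := by
  have hj' : (0 : ℝ) < j := by exact_mod_cast hj
  have h1 : ((4096 : ℝ) * j ^ 2) ^ j ≤ (8192 * j ^ 3).choose j := by
    refine le_trans ?_ (Nat.pow_le_choose (α := ℝ) j (8192 * j ^ 3))
    rw [le_div_iff₀ (by positivity)]
    have h2 : (j.factorial : ℝ) ≤ (j : ℝ) ^ j := by exact_mod_cast Nat.factorial_le_pow j
    have h3 : (4096 : ℝ) * j ^ 3 ≤ (8192 * j ^ 3 + 1 - j : ℕ) := by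
      have : 4096 * j ^ 3 ≤ 8192 * j ^ 3 + 1 - j := by
        have : j ≤ j ^ 3 := Nat.le_self_pow (by norm_num) j
        omega
      exact_mod_cast this
    calc ((4096 : ℝ) * j ^ 2) ^ j * (j.factorial : ℝ) ≤ (4096 * (j : ℝ) ^ 2) ^ j * (j : ℝ) ^ j := by gcongr
      _ = (4096 * (j : ℝ) ^ 3) ^ j := by rw [← mul_pow]; congr 1; ring
      _ ≤ _ := by gcongr
  have h4 : Real.exp j ≤ (4 : ℝ) ^ j := by
    rw [← Real.exp_one_pow]
    gcongr
    linarith [Real.exp_one_lt_d9]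
  have h5 : (2 : ℝ) ≤ 2 ^ j := by
    simpa using pow_le_pow_right₀ (by norm_num : (1 : ℝ) ≤ 2) hj
  -- Per factor: `4096 j² / (256 j² * 2) = 8`, and `8^j / 2 ≥ 4^j ≥ exp j`.
  have h6 : (((16 * j : ℕ) : ℝ) ^ (2 * j))⁻¹ * (((4096 : ℝ) * j ^ 2) ^ j / 2 ^ j) = 8 ^ j := by
    rw [pow_mul, ← div_pow, ← inv_pow, ← mul_pow]
    congr 1
    push_cast
    field_simp
    norm_num
  calc Real.exp j ≤ 4 ^ j := h4
    _ ≤ 4 ^ j * 2 ^ j / 2 := by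
      rw [mul_div_assoc]
      exact le_mul_of_one_le_right (by positivity) (by linarith)
    _ = 8 ^ j / 2 := by rw [← mul_pow]; norm_num
    _ ≤ _ := by rw [← h6]; gcongr

/-- Here `16384 = 2 * 8192`: the factor `16 * j + 1` is absorbed by a second copy of the power of
two, and `2 < e`. -/
theorem size_bound {j n : ℕ} (hj : 0 < j) (hn : 16384 * (j : ℝ) ^ 3 ≤ Real.log n) :
    (16 * j + 1) * 2 ^ (8192 * j ^ 3) ≤ n := by
  have h1 : 16 * j + 1 ≤ 2 ^ (8192 * j ^ 3) := by
    have h2 : 16 * j < 2 ^ (16 * j) := Nat.lt_two_pow_self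
    have h3 : j ≤ j ^ 3 := Nat.le_self_pow (by norm_num) j
    exact h2.trans_le (Nat.pow_le_pow_right (by norm_num) (by omega))
  have hn0 : 0 < n := by
    rcases Nat.eq_zero_or_pos n with rfl | h
    · have : (0 : ℝ) < j := by exact_mod_cast hj
      have : 0 < 16384 * (j : ℝ) ^ 3 := by positivity
      simp at hn; linarith
    · exact h
  refine (Nat.mul_le_mul_right _ h1).trans ?_
  rw [← pow_add]
  have h4 : ((2 : ℝ)) ^ (8192 * j ^ 3 + 8192 * j ^ 3) ≤ n := by
    calc (2 : ℝ) ^ (8192 * j ^ 3 + 8192 * j ^ 3)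
        ≤ Real.exp 1 ^ (8192 * j ^ 3 + 8192 * j ^ 3) := by
          gcongr; linarith [Real.exp_one_gt_d9]
      _ = Real.exp (16384 * (j : ℝ) ^ 3) := by
          rw [Real.exp_one_pow]; push_cast; congr 1; ring
      _ ≤ Real.exp (Real.log n) := Real.exp_le_exp.2 hn
      _ = n := Real.exp_log (by exact_mod_cast hn0)
  exact_mod_cast h4

end URRT

theorem mainTheorem11 :
    ∃ c : ℝ, 0 < c ∧ ∃ N : ℕ,
      ∀ (Ω : Type*) [MeasurableSpace Ω] (μ : Measure Ω) [IsProbabilityMeasure μ]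
        (parent : ∀ k : ℕ, Ω → Fin (k + 1)), URRT.IsUniformAttachment μ parent →
        ∀ (n : ℕ) [NeZero n], N ≤ n →
          Real.exp (c * (Real.log (n : ℝ)) ^ (1 / 3 : ℝ)) ≤
            ∫ ω, (URRT.rootRank (URRT.tree (fun k => parent k ω) n) : ℝ) ∂μ := by
  -- For such `n`, `L = (log n)^(1/3) ≥ 60`, so `j = ⌊L / 30⌋` is positive and at least `L / 60`;
  -- moreover `30^3 = 27000 ≥ 16384`, as `size_bound` needs.
  refine ⟨1 / 60, by norm_num, ⌈Real.exp (60 ^ 3)⌉₊, ?_⟩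
  intro Ω _ μ _ parent hP n hne hn
  have hn0 : 0 < n := Nat.pos_of_ne_zero hne.out
  have hlog : (60 : ℝ) ^ 3 ≤ Real.log n := by
    rw [Real.le_log_iff_exp_le (by exact_mod_cast hn0)]
    exact Nat.ceil_le.1 hn
  set L := Real.log (n : ℝ) ^ (1 / 3 : ℝ) with hL
  have hlog0 : 0 ≤ Real.log n := le_trans (by norm_num) hlog
  have hL3 : L ^ 3 = Real.log n := by
    rw [hL, ← Real.rpow_natCast, ← Real.rpow_mul hlog0]; norm_num
  have hL0 : 0 ≤ L := Real.rpow_nonneg hlog0 _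
  have hL60 : 60 ≤ L := by
    refine le_of_pow_le_pow_left₀ (n := 3) (by norm_num) hL0 ?_
    rwa [hL3]
  set j := ⌊L / 30⌋₊ with hj
  have hj1 : (j : ℝ) ≤ L / 30 := Nat.floor_le (by positivity)
  have hj2 : L / 30 < j + 1 := Nat.lt_floor_add_one _
  have hj0 : 0 < j := Nat.floor_pos.2 (by linarith)
  obtain ⟨m, rfl⟩ : ∃ m, n = m + 1 := ⟨n - 1, by omega⟩
  have hsize : 16384 * (j : ℝ) ^ 3 ≤ Real.log (m + 1 : ℕ) := by
    rw [← hL3]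
    have : (j : ℝ) ^ 3 ≤ (L / 30) ^ 3 := by gcongr
    have : 0 ≤ L ^ 3 := by positivity
    nlinarith
  calc Real.exp (1 / 60 * L) ≤ Real.exp j := Real.exp_le_exp.2 (by linarith)
    _ ≤ _ := URRT.exp_le_choose_bound hj0
    _ ≤ _ := hP.le_integral_rootRank hj0 (URRT.size_bound hj0 hsize)
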